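/- The kissing number in dimension three, i.e. the maximum number of non-overlapping unit spheres in $\mathbb{R}^3$ tangent to a given unit sphere, is $12$. That is, for every unit sphere $\Sigma\subset\mathbb{R}^3$, every set of pairwise non-overlapping unit spheres (the open unit balls they bound are pairwise disjoint), each of which touches $\Sigma$ (has a common point with $\Sigma$ without overlapping it), has at most $12$ members, and some such set has exactly $12$ members. -/

import Mathlib

/-- The unit spheres centred at `a` and `b` are non-overlapping: the open unit balls which they
bound have no common point. -/
def NonOverlapping {d : ℕ} (a b : EuclideanSpace ℝ (Fin d)) : Prop :=
  Disjoint (Metric.ball a 1) (Metric.ball b 1)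

/-- The unit spheres centred at `a` and `b` are tangent (touch): they have a common point and do
not overlap. -/
def Touching {d : ℕ} (a b : EuclideanSpace ℝ (Fin d)) : Prop :=
  (Metric.sphere a 1 ∩ Metric.sphere b 1).Nonempty ∧ NonOverlapping a b

/-- `S` is the set of centres of pairwise non-overlapping unit spheres, each of which is tangent to
the unit sphere centred at `o`. -/
def IsKissingConfiguration {d : ℕ} (o : EuclideanSpace ℝ (Fin d))
    (S : Set (EuclideanSpace ℝ (Fin d))) : Prop :=
  (∀ c ∈ S, Touching c o) ∧ S.Pairwise NonOverlapping

/-- The kissing number in dimension `d`: the supremum, in the extended natural numbers, of the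
numbers of non-overlapping unit spheres tangent to the unit sphere centred at the origin. -/
noncomputable def kissingNumber (d : ℕ) : ℕ∞ :=
  ⨆ (S : Set (EuclideanSpace ℝ (Fin d))) (_ : IsKissingConfiguration 0 S), S.encard

/-! The upper bound is a Delsarte linear programming argument with a correction near the antipode.
Halving the vectors from the given centre to the touching centres turns a configuration into a set
`T` of unit vectors with pairwise inner products at most 1/2. `kissingPoly` has nonnegative Legendre
coefficients and constant coefficient 1, so its sum over all ordered pairs from `T` is at least
`T.card ^ 2` (`card_sq_le_sum_sum_kissingPoly`).

Each row of this double sum is below 13 (`sum_kissingPoly_lt`), which forces `T.card < 13`. In the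
row of `x` the diagonal gives 11.05, and a positive off-diagonal term can come only from a `y`
within about 45 degrees of `-x`. At most three points of `T` lie in that cap (`not_four_in_cap`),
and together they contribute at most 1.949, by one-variable inequalities checked in integer
arithmetic.

The lower bound comes from the face-centred cubic lattice. -/

/-! ### Certified nonnegativity of integer polynomials on the unit interval -/

namespace IntPoly

/-- The value at `x` of the polynomial with the given coefficients, constant term first. -/
def eval : List ℤ → ℝ → ℝ
  | [], _ => 0
  | c :: p, x => c + x * eval p x

/-- A lower bound for the values of a polynomial on the unit interval. -/
def lowerBound : List ℤ → ℤ
  | [] => 0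
  | c :: p => c + min 0 (lowerBound p)

/-- The coefficients of `2 ^ n * p (x / 2)`, where `n` is the length of `p`. -/
def halve : List ℤ → List ℤ
  | [] => []
  | c :: p => 2 ^ (p.length + 1) * c :: halve p

/-- The coefficients of `c + (1 + x) * p x`. -/
def addMulOneAdd : ℤ → List ℤ → List ℤ
  | c, [] => [c]
  | c, a :: p => (c + a) :: addMulOneAdd a p

/-- The coefficients of `p (x + 1)`. -/
def shift : List ℤ → List ℤ
  | [] => []
  | c :: p => addMulOneAdd c (shift p)

/-- Checks nonnegativity on the unit interval with at most `n` successive bisections. -/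
def check : ℕ → List ℤ → Bool
  | 0, p => decide (0 ≤ lowerBound p)
  | n + 1, p => decide (0 ≤ lowerBound p) || (check n (halve p) && check n (shift (halve p)))

theorem lowerBound_le_eval (p : List ℤ) {x : ℝ} (h0 : 0 ≤ x) (h1 : x ≤ 1) :
    (lowerBound p : ℝ) ≤ eval p x := by
  induction p with
  | nil => simp [lowerBound, eval]
  | cons c p ih =>
    simp only [lowerBound, eval, Int.cast_add, Int.cast_min, Int.cast_zero]
    have h : min 0 (lowerBound p : ℝ) ≤ x * eval p x := by
      rcases le_total 0 (eval p x) with he | he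
      · exact (min_le_left _ _).trans (mul_nonneg h0 he)
      · exact (min_le_right _ _).trans (ih.trans (by nlinarith))
    linarith

theorem eval_halve (p : List ℤ) (x : ℝ) : eval (halve p) x = 2 ^ p.length * eval p (x / 2) := by
  induction p with
  | nil => simp [halve, eval]
  | cons c p ih =>
    simp only [halve, eval, ih, List.length_cons]
    push_cast
    ring

theorem eval_addMulOneAdd (c : ℤ) (p : List ℤ) (x : ℝ) :
    eval (addMulOneAdd c p) x = c + (1 + x) * eval p x := by
  induction p generalizing c with
  | nil => simp [addMulOneAdd, eval]
  | cons a p ih =>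
    simp only [addMulOneAdd, eval, ih]
    push_cast
    ring

theorem eval_shift (p : List ℤ) (x : ℝ) : eval (shift p) x = eval p (x + 1) := by
  induction p with
  | nil => simp [shift, eval]
  | cons c p ih => simp only [shift, eval_addMulOneAdd, eval, ih]; ring

theorem eval_nonneg_of_check {n : ℕ} {p : List ℤ} (h : check n p = true) {x : ℝ} (h0 : 0 ≤ x)
    (h1 : x ≤ 1) : 0 ≤ eval p x := by
  have key : ∀ p : List ℤ, 0 ≤ lowerBound p → ∀ x : ℝ, 0 ≤ x → x ≤ 1 → 0 ≤ eval p x :=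
    fun p hp x h0 h1 => le_trans (by exact_mod_cast hp) (lowerBound_le_eval p h0 h1)
  induction n generalizing p x with
  | zero => exact key p (by simpa [check] using h) x h0 h1
  | succ n ih =>
    simp only [check, Bool.or_eq_true, decide_eq_true_eq, Bool.and_eq_true] at h
    rcases h with h | ⟨hl, hr⟩
    · exact key p h x h0 h1
    · have hpos : (0 : ℝ) < 2 ^ p.length := by positivity
      rcases le_total x (1 / 2) with hx | hx
      · have := ih hl (x := 2 * x) (by linarith) (by linarith)
        rw [eval_halve, mul_div_cancel_left₀ x two_ne_zero] at this
        exact nonneg_of_mul_nonneg_right this hpos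
      · have := ih hr (x := 2 * x - 1) (by linarith) (by linarith)
        rw [eval_shift, eval_halve, sub_add_cancel, mul_div_cancel_left₀ x two_ne_zero] at this
        exact nonneg_of_mul_nonneg_right this hpos

/-- A polynomial function on `[u, v]` is nonnegative if a positive multiple of it, moved to the
unit interval, has an integer coefficient list which passes the check. -/
theorem nonneg_of_check {F : ℝ → ℝ} {u v N : ℝ} (n : ℕ) (p : List ℤ) (h : check n p = true)
    (huv : u < v) (hN : 0 < N) (hF : ∀ x, N * F (u + (v - u) * x) = eval p x) {t : ℝ}
    (hu : u ≤ t) (hv : t ≤ v) : 0 ≤ F t := by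
  have hd : 0 < v - u := sub_pos.2 huv
  have := eval_nonneg_of_check h (x := (t - u) / (v - u)) (div_nonneg (by linarith) hd.le)
    ((div_le_one hd).2 (by linarith))
  rw [← hF, mul_div_cancel₀ _ hd.ne', add_sub_cancel] at this
  exact nonneg_of_mul_nonneg_right this hN

end IntPoly

/-! ### Legendre polynomials and the polynomial of the linear programming bound -/

/-- The second Legendre polynomial. -/
noncomputable def legendreTwo (t : ℝ) : ℝ :=
  3 / 2 * t ^ 2 - 1 / 2

/-- The third Legendre polynomial. -/
noncomputable def legendreThree (t : ℝ) : ℝ :=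
  5 / 2 * t ^ 3 - 3 / 2 * t

/-- The fourth Legendre polynomial. -/
noncomputable def legendreFour (t : ℝ) : ℝ :=
  35 / 8 * t ^ 4 - 15 / 4 * t ^ 2 + 3 / 8

/-- The fifth Legendre polynomial. -/
noncomputable def legendreFive (t : ℝ) : ℝ :=
  63 / 8 * t ^ 5 - 35 / 4 * t ^ 3 + 15 / 8 * t

/-- The ninth Legendre polynomial. -/
noncomputable def legendreNine (t : ℝ) : ℝ :=
  12155 / 128 * t ^ 9 - 6435 / 32 * t ^ 7 + 9009 / 64 * t ^ 5 - 1155 / 32 * t ^ 3 + 315 / 128 * t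

/-- A polynomial with nonnegative Legendre coefficients, adapted to kissing configurations in
dimension three. -/
noncomputable def kissingPoly (t : ℝ) : ℝ :=
  1 + 79 / 40 * t + 1747 / 500 * legendreTwo t + 2053 / 1000 * legendreThree t
    + 993 / 500 * legendreFour t + 183 / 1000 * legendreFive t + 359 / 1000 * legendreNine t

theorem kissingPoly_eq (t : ℝ) : kissingPoly t =
    872729 / 25600 * t ^ 9 - 462033 / 6400 * t ^ 7 + 3326463 / 64000 * t ^ 5
      + 6951 / 800 * t ^ 4 - 60329 / 6400 * t ^ 3 - 4413 / 2000 * t ^ 2 + 15629 / 128000 * t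
      - 9 / 4000 := by
  simp only [kissingPoly, legendreTwo, legendreThree, legendreFour, legendreFive, legendreNine]
  ring

theorem kissingPoly_one : kissingPoly 1 = 221 / 20 := by
  rw [kissingPoly_eq]
  norm_num

/-- The cutoff 99/140 lies just above `1 / √2`; `not_four_in_cap` needs its square to exceed 1/2. -/
theorem kissingPoly_nonpos {t : ℝ} (hu : -(99 / 140) ≤ t) (hv : t ≤ 1 / 2) :
    kissingPoly t ≤ 0 := by
  have h := IntPoly.nonneg_of_check (F := fun t => -kissingPoly t)
    (u := -(99 / 140)) (v := 1 / 2)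
    -- `N` clears the denominators after the move to the unit interval; 8 bounds the bisection
    -- depth.
    (N := 528922797670400000000000) 8
    [322377144948683258571, 1410177178599024403363991, -15124476786373953171004884,
     44516273660221911169734476, 46204886411321145172840266, -498869596056026160480906846,
     1072389215477383340455602684, -1069812025736919899960184516, 517428979377002177275375299,
     -98143094853774823748079041]
    (by decide +kernel) (by norm_num) (by norm_num)
    (fun x => by simp only [kissingPoly_eq, IntPoly.eval]; push_cast; ring) hu hv
  linarith

/-- The constant 1949/1000 is the budget for the cap: with the diagonal value 221/20 it totals
12.999. -/
theorem kissingPoly_neg_le {t : ℝ} (hu : 99 / 140 ≤ t) (hv : t ≤ 1) :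
    kissingPoly (-t) ≤ 1949 / 1000 := by
  have h := IntPoly.nonneg_of_check (F := fun t => 1949 / 1000 - kissingPoly (-t))
    (u := 99 / 140) (v := 1)
    (N := 528922797670400000000000) 8
    [1031192909804558283258571, -342113990074319529810199, -890173505055656849566164,
     -635638596210489029031244, 160057679169522475916106, 419249735132475438037854,
     218642885613224527779324, 52916064874644159008964, 6209090146964417217219,
     285715708221707189569]
    (by decide +kernel) (by norm_num) (by norm_num)
    (fun x => by simp only [kissingPoly_eq, IntPoly.eval]; push_cast; ring) hu hv
  linarith

/-- A quadratic majorant reduces the case of three points in the cap to the sum and the sum of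
squares of their heights. -/
theorem kissingPoly_neg_le_quadratic {t : ℝ} (hu : 99 / 140 ≤ t) (hv : t ≤ 1) :
    kissingPoly (-t) ≤ 17 / 5 - 14 * t + 13 * t ^ 2 := by
  have h := IntPoly.nonneg_of_check (F := fun t => 17 / 5 - 14 * t + 13 * t ^ 2 - kissingPoly (-t))
    (u := 99 / 140) (v := 1)
    (N := 528922797670400000000000) 8
    [673193286260683258571, 337227974647856470189801, -300451571510184849566164,
     -635638596210489029031244, 160057679169522475916106, 419249735132475438037854,
     218642885613224527779324, 52916064874644159008964, 6209090146964417217219,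
     285715708221707189569]
    (by decide +kernel) (by norm_num) (by norm_num)
    (fun x => by simp only [kissingPoly_eq, IntPoly.eval]; push_cast; ring) hu hv
  linarith

/-- For two points in the cap, the larger height is bounded by a linear function of the smaller one;
see `kissingPoly_add_le_of_two` for the lines used here and in `kissingPoly_neg_add_le_lower`. -/
theorem kissingPoly_neg_add_le_upper {t : ℝ} (hu : 4 / 5 ≤ t) (hv : t ≤ 13 / 15) :
    kissingPoly (-t) + kissingPoly (-(725 / 456 - 5 / 6 * t)) ≤ 1949 / 1000 := by
  have h := IntPoly.nonneg_of_check
    (F := fun t => 1949 / 1000 - kissingPoly (-t) - kissingPoly (-(725 / 456 - 5 / 6 * t)))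
    (u := 4 / 5) (v := 13 / 15)
    (N := 838967004258973642819790438400000000000) 8
    [8362302146315494498048554007944933843, 60149242336834416253852040141112755076,
     -34987064558187418208370602696033587008, -46019357176941670140936202683131824896,
     14172319446868379509769026635856869888, 94295466581997806426017374271617024,
     122293214979291779878279304051539968, 2167699091693416401872237790560256,
     101915884277306842229205606531072, 599794081810602314359311171584]
    (by decide +kernel) (by norm_num) (by norm_num)
    (fun x => by simp only [kissingPoly_eq, IntPoly.eval]; push_cast; ring) hu hv
  linarith

theorem kissingPoly_neg_add_le_lower {t : ℝ} (hu : 99 / 140 ≤ t) (hv : t ≤ 4 / 5) :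
    kissingPoly (-t) + kissingPoly (-(7 / 5 - 3 / 5 * t)) ≤ 1949 / 1000 := by
  have h := IntPoly.nonneg_of_check
    (F := fun t => 1949 / 1000 - kissingPoly (-t) - kissingPoly (-(7 / 5 - 3 / 5 * t)))
    (u := 99 / 140) (v := 4 / 5)
    (N := 10541350400000000000000000000) 8
    [522048718947600971197916069, -257107262773434854573516243, 1499769068370722242054739076,
     -1556523555918639863148263852, 204543034340052444498363174, 12620316720367937265442758,
     5111080986564986943834324, 320532646103934626208132, 12934747164513683741661,
     182589017195854333493]
    (by decide +kernel) (by norm_num) (by norm_num)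
    (fun x => by simp only [kissingPoly_eq, IntPoly.eval]; push_cast; ring) hu hv
  linarith

theorem hasDerivAt_kissingPoly_neg (t : ℝ) : HasDerivAt (fun t => kissingPoly (-t))
    (-7854561 / 25600 * t ^ 8 + 3234231 / 6400 * t ^ 6 - 3326463 / 12800 * t ^ 4 + 6951 / 200 * t ^ 3
      + 180987 / 6400 * t ^ 2 - 4413 / 1000 * t - 15629 / 128000) t := by
  have h := ((((((((hasDerivAt_pow 9 t).const_mul (-872729 / 25600)).fun_add
    ((hasDerivAt_pow 7 t).const_mul (462033 / 6400))).fun_add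
    ((hasDerivAt_pow 5 t).const_mul (-3326463 / 64000))).fun_add
    ((hasDerivAt_pow 4 t).const_mul (6951 / 800))).fun_add
    ((hasDerivAt_pow 3 t).const_mul (60329 / 6400))).fun_add
    ((hasDerivAt_pow 2 t).const_mul (-4413 / 2000))).fun_add
    ((hasDerivAt_pow 1 t).const_mul (-15629 / 128000))).add_const ((-9 / 4000) : ℝ)
  refine (h.congr_of_eventuallyEq (.of_forall fun s => ?_)).congr_deriv ?_
  · simp only [kissingPoly_eq]
    ring
  · push_cast
    ring

theorem monotoneOn_kissingPoly_neg :
    MonotoneOn (fun t => kissingPoly (-t)) (Set.Icc (99 / 140) (49 / 50)) := by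
  refine monotoneOn_of_deriv_nonneg (convex_Icc _ _)
    (fun t _ => (hasDerivAt_kissingPoly_neg t).continuousAt.continuousWithinAt)
    (fun t _ => (hasDerivAt_kissingPoly_neg t).differentiableAt.differentiableWithinAt)
    (fun t ht => ?_)
  rw [interior_Icc] at ht
  rw [(hasDerivAt_kissingPoly_neg t).deriv]
  exact IntPoly.nonneg_of_check
    (F := fun t => -7854561 / 25600 * t ^ 8 + 3234231 / 6400 * t ^ 6 - 3326463 / 12800 * t ^ 4 + 6951 / 200 * t ^ 3
      + 180987 / 6400 * t ^ 2 - 4413 / 1000 * t - 15629 / 128000)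
    (u := 99 / 140) (v := 49 / 50) (N := 1475789056000000000000000000) 0
    [3259470179823928447124609375, 15803757014577489056656875000, 15771271384326019737332062500,
     -4933455363938332646427075000, -15050017467255756818451543750,
     -8775266402212201054486323000, -2308547396153020901799620700, -288436803182363566485972360,
     -13911977123189757878490081]
    (by decide +kernel) (by norm_num) (by norm_num)
    (fun x => by simp only [IntPoly.eval]; push_cast; ring) ht.1.le ht.2.le

/-! ### Positive definite kernels on the two-dimensional sphere -/

/-- The polynomial with `scaledChebyshev m (Re w) (|w| ^ 2) = Re (w ^ m)`. -/
def scaledChebyshev : ℕ → ℝ → ℝ → ℝ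
  | 0, _, _ => 1
  | 1, c, _ => c
  | m + 2, c, r => 2 * c * scaledChebyshev (m + 1) c r - r * scaledChebyshev m c r

/-- The recursion is that of the powers of a root of `w ^ 2 = 2 * Re w * w - |w| ^ 2`. -/
theorem re_pow_eq_scaledChebyshev (w : ℂ) :
    ∀ m : ℕ, (w ^ m).re = scaledChebyshev m w.re (Complex.normSq w)
  | 0 => by simp [scaledChebyshev]
  | 1 => by simp [scaledChebyshev]
  | m + 2 => by
    rw [scaledChebyshev, ← re_pow_eq_scaledChebyshev w m, ← re_pow_eq_scaledChebyshev w (m + 1)]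
    have h : w ^ (m + 2) = ((2 * w.re : ℝ) : ℂ) * w ^ (m + 1)
        - ((Complex.normSq w : ℝ) : ℂ) * w ^ m := by
      rw [← Complex.mul_conj, ← Complex.add_conj]
      ring
    rw [h, Complex.sub_re, Complex.re_ofReal_mul, Complex.re_ofReal_mul]

theorem sum_sum_mul_re_pow_nonneg {ι : Type*} (T : Finset ι) (a : ι → ℝ) (w : ι → ℂ) (m : ℕ) :
    0 ≤ ∑ x ∈ T, ∑ y ∈ T, a x * a y * ((w x * starRingEnd ℂ (w y)) ^ m).re := by
  have h : ∑ x ∈ T, ∑ y ∈ T, a x * a y * ((w x * starRingEnd ℂ (w y)) ^ m).re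
      = Complex.normSq (∑ x ∈ T, (a x : ℂ) * w x ^ m) := by
    rw [← Complex.ofReal_re (Complex.normSq _), ← Complex.mul_conj, map_sum, Finset.sum_mul_sum,
      Complex.re_sum]
    refine Finset.sum_congr rfl fun x _ => ?_
    rw [Complex.re_sum]
    refine Finset.sum_congr rfl fun y _ => ?_
    rw [← Complex.re_ofReal_mul]
    congr 1
    simp only [map_mul, map_pow, Complex.conj_ofReal, Complex.ofReal_mul]
    ring
  rw [h]
  exact Complex.normSq_nonneg _

theorem inner_eq_sum_three (x y : EuclideanSpace ℝ (Fin 3)) :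
    inner ℝ x y = x 0 * y 0 + x 1 * y 1 + x 2 * y 2 := by
  simp [PiLp.inner_apply, Fin.sum_univ_three, mul_comm]

/-- An addition theorem for `p` gives positive definiteness of the zonal kernel of `p`. -/
theorem sum_sum_zonal_nonneg {p : ℝ → ℝ} {n : ℕ} (κ : Fin n → ℝ) (a : Fin n → ℝ → ℝ)
    (hκ : ∀ m, 0 ≤ κ m)
    (hp : ∀ z w c : ℝ, p (z * w + c) = ∑ m : Fin n,
      κ m * (a m z * a m w * scaledChebyshev m c ((1 - z ^ 2) * (1 - w ^ 2))))
    {T : Finset (EuclideanSpace ℝ (Fin 3))} (hT : ∀ x ∈ T, ‖x‖ = 1) :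
    0 ≤ ∑ x ∈ T, ∑ y ∈ T, p (inner ℝ x y) := by
  have hsq : ∀ x ∈ T, x 0 ^ 2 + x 1 ^ 2 = 1 - x 2 ^ 2 := fun x hx => by
    have := real_inner_self_eq_norm_sq x
    rw [hT x hx, inner_eq_sum_three] at this
    linarith
  -- With the first two coordinates read as a complex number, `c` is the real part of one such
  -- number times the conjugate of another, and `1 - z ^ 2` is a squared modulus.
  have h : ∑ x ∈ T, ∑ y ∈ T, p (inner ℝ x y) = ∑ m : Fin n, κ m * ∑ x ∈ T, ∑ y ∈ T,
      a m (x 2) * a m (y 2) *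
        (((⟨x 0, x 1⟩ : ℂ) * starRingEnd ℂ (⟨y 0, y 1⟩ : ℂ)) ^ (m : ℕ)).re := by
    simp only [Finset.mul_sum]
    rw [eq_comm, Finset.sum_comm]
    refine Finset.sum_congr rfl fun x hx => ?_
    rw [Finset.sum_comm]
    refine Finset.sum_congr rfl fun y hy => ?_
    rw [eq_comm, show inner ℝ x y = x 2 * y 2 + (x 0 * y 0 + x 1 * y 1) by
      rw [inner_eq_sum_three]; ring, hp]
    refine Finset.sum_congr rfl fun m _ => ?_
    rw [re_pow_eq_scaledChebyshev, map_mul, Complex.normSq_conj, Complex.normSq_mk,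
      Complex.normSq_mk, ← hsq x hx, ← hsq y hy]
    simp only [Complex.mul_re, Complex.conj_re, Complex.conj_im]
    ring_nf
  rw [h]
  exact Finset.sum_nonneg fun m _ => mul_nonneg (hκ m) (sum_sum_mul_re_pow_nonneg _ _ _ _)

theorem sum_sum_inner_nonneg (T : Finset (EuclideanSpace ℝ (Fin 3))) :
    0 ≤ ∑ x ∈ T, ∑ y ∈ T, inner ℝ x y := by
  have h : ∑ x ∈ T, ∑ y ∈ T, inner ℝ x y = inner ℝ (∑ x ∈ T, x) (∑ y ∈ T, y) := by
    simp_rw [sum_inner, inner_sum]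
  rw [h]
  exact real_inner_self_nonneg

/-- The table is the addition theorem: entry `m` of the second vector is a multiple of the `m`-th
derivative of the Legendre polynomial. The higher degrees follow the same pattern. -/
theorem sum_sum_legendreTwo_nonneg {T : Finset (EuclideanSpace ℝ (Fin 3))}
    (hT : ∀ x ∈ T, ‖x‖ = 1) : 0 ≤ ∑ x ∈ T, ∑ y ∈ T, legendreTwo (inner ℝ x y) := by
  refine sum_sum_zonal_nonneg (n := 3)
    ![1 / 4, 3, 3 / 4]
    ![fun z => 3 * z ^ 2 - 1, fun z => z, fun _ => 1]
    (fun m => by fin_cases m <;> norm_num) (fun z w c => ?_) hT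
  simp [Fin.sum_univ_succ, scaledChebyshev, legendreTwo]
  ring

theorem sum_sum_legendreThree_nonneg {T : Finset (EuclideanSpace ℝ (Fin 3))}
    (hT : ∀ x ∈ T, ‖x‖ = 1) : 0 ≤ ∑ x ∈ T, ∑ y ∈ T, legendreThree (inner ℝ x y) := by
  refine sum_sum_zonal_nonneg (n := 4)
    ![1 / 4, 3 / 8, 15 / 4, 5 / 8]
    ![fun z => 5 * z ^ 3 - 3 * z, fun z => 5 * z ^ 2 - 1, fun z => z, fun _ => 1]
    (fun m => by fin_cases m <;> norm_num) (fun z w c => ?_) hT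
  simp [Fin.sum_univ_succ, scaledChebyshev, legendreThree]
  ring

theorem sum_sum_legendreFour_nonneg {T : Finset (EuclideanSpace ℝ (Fin 3))}
    (hT : ∀ x ∈ T, ‖x‖ = 1) : 0 ≤ ∑ x ∈ T, ∑ y ∈ T, legendreFour (inner ℝ x y) := by
  refine sum_sum_zonal_nonneg (n := 5)
    ![1 / 64, 5 / 8, 5 / 16, 35 / 8, 35 / 64]
    ![fun z => 35 * z ^ 4 - 30 * z ^ 2 + 3, fun z => 7 * z ^ 3 - 3 * z, fun z => 7 * z ^ 2 - 1,
      fun z => z, fun _ => 1]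
    (fun m => by fin_cases m <;> norm_num) (fun z w c => ?_) hT
  simp [Fin.sum_univ_succ, scaledChebyshev, legendreFour]
  ring

theorem sum_sum_legendreFive_nonneg {T : Finset (EuclideanSpace ℝ (Fin 3))}
    (hT : ∀ x ∈ T, ‖x‖ = 1) : 0 ≤ ∑ x ∈ T, ∑ y ∈ T, legendreFive (inner ℝ x y) := by
  refine sum_sum_zonal_nonneg (n := 6)
    ![1 / 64, 15 / 64, 105 / 16, 35 / 128, 315 / 64, 63 / 128]
    ![fun z => 63 * z ^ 5 - 70 * z ^ 3 + 15 * z, fun z => 21 * z ^ 4 - 14 * z ^ 2 + 1,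
      fun z => 3 * z ^ 3 - z, fun z => 9 * z ^ 2 - 1, fun z => z, fun _ => 1]
    (fun m => by fin_cases m <;> norm_num) (fun z w c => ?_) hT
  simp [Fin.sum_univ_succ, scaledChebyshev, legendreFive]
  ring

theorem sum_sum_legendreNine_nonneg {T : Finset (EuclideanSpace ℝ (Fin 3))}
    (hT : ∀ x ∈ T, ‖x‖ = 1) : 0 ≤ ∑ x ∈ T, ∑ y ∈ T, legendreNine (inner ℝ x y) := by
  refine sum_sum_zonal_nonneg (n := 10)
    ![1 / 16384, 45 / 16384, 495 / 2048, 1155 / 8192, 45045 / 4096, 1287 / 8192, 2145 / 2048,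
      6435 / 32768, 109395 / 16384, 12155 / 32768]
    ![fun z => 12155 * z ^ 9 - 25740 * z ^ 7 + 18018 * z ^ 5 - 4620 * z ^ 3 + 315 * z,
      fun z => 2431 * z ^ 8 - 4004 * z ^ 6 + 2002 * z ^ 4 - 308 * z ^ 2 + 7,
      fun z => 221 * z ^ 7 - 273 * z ^ 5 + 91 * z ^ 3 - 7 * z,
      fun z => 221 * z ^ 6 - 195 * z ^ 4 + 39 * z ^ 2 - 1, fun z => 17 * z ^ 5 - 10 * z ^ 3 + z,
      fun z => 85 * z ^ 4 - 30 * z ^ 2 + 1, fun z => 17 * z ^ 3 - 3 * z, fun z => 17 * z ^ 2 - 1,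
      fun z => z, fun _ => 1]
    (fun m => by fin_cases m <;> norm_num) (fun z w c => ?_) hT
  simp [Fin.sum_univ_succ, scaledChebyshev, legendreNine]
  ring

theorem card_sq_le_sum_sum_kissingPoly {T : Finset (EuclideanSpace ℝ (Fin 3))}
    (hT : ∀ x ∈ T, ‖x‖ = 1) : (T.card : ℝ) ^ 2 ≤ ∑ x ∈ T, ∑ y ∈ T, kissingPoly (inner ℝ x y) := by
  have h1 := sum_sum_inner_nonneg T
  have h2 := sum_sum_legendreTwo_nonneg hT
  have h3 := sum_sum_legendreThree_nonneg hT
  have h4 := sum_sum_legendreFour_nonneg hT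
  have h5 := sum_sum_legendreFive_nonneg hT
  have h9 := sum_sum_legendreNine_nonneg hT
  simp only [kissingPoly, Finset.sum_add_distrib, ← Finset.mul_sum, Finset.sum_const, nsmul_eq_mul,
    mul_one]
  nlinarith

/-! ### Points in a spherical cap -/

section Cap

variable {e x y z w : EuclideanSpace ℝ (Fin 3)}

theorem inner_sq_le_inner_self {E : Type*} [NormedAddCommGroup E] [InnerProductSpace ℝ E]
    {e : E} (he : ‖e‖ = 1) (v : E) : inner ℝ e v ^ 2 ≤ inner ℝ v v := by
  rw [real_inner_self_eq_norm_sq, sq_le_sq, abs_norm]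
  simpa [he] using abs_real_inner_le_norm e v

theorem sq_add_sq_sub_mul_le {E : Type*} [NormedAddCommGroup E] [InnerProductSpace ℝ E]
    {e x y : E} (he : ‖e‖ = 1) (hx : ‖x‖ = 1) (hy : ‖y‖ = 1) (hxy : inner ℝ x y ≤ 1 / 2)
    (h1 : inner ℝ e y ≤ 2 * inner ℝ e x) (h2 : inner ℝ e x ≤ 2 * inner ℝ e y) :
    inner ℝ e x ^ 2 + inner ℝ e y ^ 2 - inner ℝ e x * inner ℝ e y ≤ 3 / 4 := by
  have hxx : inner ℝ x x = 1 := by rw [real_inner_self_eq_norm_sq, hx, one_pow]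
  have hyy : inner ℝ y y = 1 := by rw [real_inner_self_eq_norm_sq, hy, one_pow]
  set a := inner ℝ e x with ha
  set b := inner ℝ e y with hb
  -- The weights are, up to scale, the inverse of the Gram matrix with off-diagonal entry 1/2
  -- applied to `(a, b)`. Being nonnegative, they let `hxy` bound the norm; with `Q = a ^ 2 + b ^ 2
  -- - a * b` this reads `4 * Q ^ 2 ≤ 3 * Q`.
  have h := inner_sq_le_inner_self he ((2 * a - b) • x + (2 * b - a) • y)
  simp only [inner_add_left, inner_add_right, real_inner_smul_left, real_inner_smul_right,
    hxx, hyy, real_inner_comm x y, ← ha, ← hb] at h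
  have h' := mul_le_mul_of_nonneg_left hxy (mul_nonneg (sub_nonneg.2 h1) (sub_nonneg.2 h2))
  by_contra! hc
  nlinarith [mul_pos (sub_pos.2 hc) (lt_trans (by norm_num : (0 : ℝ) < 3 / 4) hc)]

theorem add_add_sq_le_six {E : Type*} [NormedAddCommGroup E] [InnerProductSpace ℝ E]
    {e x y z : E} (he : ‖e‖ = 1) (hx : ‖x‖ = 1) (hy : ‖y‖ = 1) (hz : ‖z‖ = 1)
    (hxy : inner ℝ x y ≤ 1 / 2) (hxz : inner ℝ x z ≤ 1 / 2) (hyz : inner ℝ y z ≤ 1 / 2) :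
    (inner ℝ e x + inner ℝ e y + inner ℝ e z) ^ 2 ≤ 6 := by
  have h := inner_sq_le_inner_self he (x + y + z)
  simp only [inner_add_left, inner_add_right, real_inner_self_eq_norm_sq, hx, hy, hz,
    real_inner_comm x y, real_inner_comm x z, real_inner_comm y z] at h
  linarith

theorem sum_sq_sub_sq_sum_le {E : Type*} [NormedAddCommGroup E] [InnerProductSpace ℝ E]
    {e x y z : E} (he : ‖e‖ = 1) (hx : ‖x‖ = 1) (hy : ‖y‖ = 1) (hz : ‖z‖ = 1)
    (hxy : inner ℝ x y ≤ 1 / 2) (hxz : inner ℝ x z ≤ 1 / 2) (hyz : inner ℝ y z ≤ 1 / 2)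
    (h1 : (inner ℝ e x + inner ℝ e y + inner ℝ e z) / 4 ≤ inner ℝ e x)
    (h2 : (inner ℝ e x + inner ℝ e y + inner ℝ e z) / 4 ≤ inner ℝ e y)
    (h3 : (inner ℝ e x + inner ℝ e y + inner ℝ e z) / 4 ≤ inner ℝ e z) :
    inner ℝ e x ^ 2 + inner ℝ e y ^ 2 + inner ℝ e z ^ 2
      - (inner ℝ e x + inner ℝ e y + inner ℝ e z) ^ 2 / 4 ≤ 1 / 2 := by
  have hxx : inner ℝ x x = 1 := by rw [real_inner_self_eq_norm_sq, hx, one_pow]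
  have hyy : inner ℝ y y = 1 := by rw [real_inner_self_eq_norm_sq, hy, one_pow]
  have hzz : inner ℝ z z = 1 := by rw [real_inner_self_eq_norm_sq, hz, one_pow]
  set a := inner ℝ e x with ha
  set b := inner ℝ e y with hb
  set c := inner ℝ e z with hc
  set S := a + b + c with hS
  -- Again the inverse Gram matrix for mutual angles of sixty degrees, now of size three, supplies
  -- the weights.
  have h := inner_sq_le_inner_self he ((a - S / 4) • x + (b - S / 4) • y + (c - S / 4) • z)
  simp only [inner_add_left, inner_add_right, real_inner_smul_left, real_inner_smul_right,
    hxx, hyy, hzz, real_inner_comm x y, real_inner_comm x z, real_inner_comm y z, ← ha, ← hb,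
    ← hc] at h
  have h12 := mul_le_mul_of_nonneg_left hxy (mul_nonneg (sub_nonneg.2 h1) (sub_nonneg.2 h2))
  have h13 := mul_le_mul_of_nonneg_left hxz (mul_nonneg (sub_nonneg.2 h1) (sub_nonneg.2 h3))
  have h23 := mul_le_mul_of_nonneg_left hyz (mul_nonneg (sub_nonneg.2 h2) (sub_nonneg.2 h3))
  set Q := a ^ 2 + b ^ 2 + c ^ 2 - S ^ 2 / 4 with hQ
  have hQQ : Q ^ 2 ≤ Q / 2 := by
    have e1 : ((a - S / 4) * a + (b - S / 4) * b + (c - S / 4) * c) = Q := by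
      rw [hQ, hS]; ring
    have e2 : (a - S / 4) ^ 2 + (b - S / 4) ^ 2 + (c - S / 4) ^ 2 + (a - S / 4) * (b - S / 4)
        + (a - S / 4) * (c - S / 4) + (b - S / 4) * (c - S / 4) = Q / 2 := by
      rw [hQ, hS]; ring
    rw [e1] at h
    linarith
  nlinarith

/-- At most three unit vectors at mutual angles at least sixty degrees lie strictly within
forty-five degrees of a given unit vector. Only the norm of the vector `x` which is projected out
matters. -/
theorem not_four_in_cap (he : ‖e‖ = 1) (hx : ‖x‖ = 1) (hxy : inner ℝ x y ≤ 1 / 2) (hxz : inner ℝ x z ≤ 1 / 2)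
    (hxw : inner ℝ x w ≤ 1 / 2) (hyz : inner ℝ y z ≤ 1 / 2) (hyw : inner ℝ y w ≤ 1 / 2)
    (hzw : inner ℝ z w ≤ 1 / 2) (hex : 99 / 140 ≤ inner ℝ e x) (hey : 99 / 140 ≤ inner ℝ e y)
    (hez : 99 / 140 ≤ inner ℝ e z) (hew : 99 / 140 ≤ inner ℝ e w) : False := by
  obtain ⟨d, gram⟩ : ∃ d : EuclideanSpace ℝ (Fin 3) → ℝ, ∀ u v, d u * d v
      = (1 - inner ℝ e x ^ 2) * (inner ℝ u v - inner ℝ e u * inner ℝ e v)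
        - (inner ℝ x u - inner ℝ e x * inner ℝ e u)
          * (inner ℝ x v - inner ℝ e x * inner ℝ e v) := by
    -- The witness is `det (e, x, v)`; a product of two such determinants is a Gram determinant.
    refine ⟨fun v => e 0 * (x 1 * v 2 - x 2 * v 1) - e 1 * (x 0 * v 2 - x 2 * v 0)
      + e 2 * (x 0 * v 1 - x 1 * v 0), fun u v => ?_⟩
    have he1 : inner ℝ e e = 1 := by rw [real_inner_self_eq_norm_sq, he, one_pow]
    have hx1 : inner ℝ x x = 1 := by rw [real_inner_self_eq_norm_sq, hx, one_pow]
    have h : (1 - inner ℝ e x ^ 2) * (inner ℝ u v - inner ℝ e u * inner ℝ e v)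
        - (inner ℝ x u - inner ℝ e x * inner ℝ e u) * (inner ℝ x v - inner ℝ e x * inner ℝ e v)
        = inner ℝ e e * (inner ℝ x x * inner ℝ u v - inner ℝ x u * inner ℝ x v)
        - inner ℝ e x * (inner ℝ e x * inner ℝ u v - inner ℝ e u * inner ℝ x v)
        + inner ℝ e v * (inner ℝ e x * inner ℝ x u - inner ℝ e u * inner ℝ x x) := by
      rw [he1, hx1]
      ring
    rw [h]
    simp only [inner_eq_sum_three]
    ring
  have hneg : ∀ {u v : EuclideanSpace ℝ (Fin 3)}, inner ℝ u v ≤ 1 / 2 → 99 / 140 ≤ inner ℝ e u →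
      99 / 140 ≤ inner ℝ e v → inner ℝ u v - inner ℝ e u * inner ℝ e v < 0 :=
    fun huv hu hv => by nlinarith
  have hx' : 0 ≤ 1 - inner ℝ e x ^ 2 := by
    have := inner_sq_le_inner_self he x
    rw [real_inner_self_eq_norm_sq, hx] at this
    linarith
  have hd : ∀ {u v : EuclideanSpace ℝ (Fin 3)}, inner ℝ u v ≤ 1 / 2 → inner ℝ x u ≤ 1 / 2 →
      inner ℝ x v ≤ 1 / 2 → 99 / 140 ≤ inner ℝ e u → 99 / 140 ≤ inner ℝ e v → d u * d v < 0 := by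
    intro u v huv hxu hxv hu hv
    rw [gram]
    have h1 := mul_nonneg hx' (neg_nonneg.2 (hneg huv hu hv).le)
    have h2 := mul_pos_of_neg_of_neg (hneg hxu hex hu) (hneg hxv hex hv)
    linarith
  -- Three real numbers cannot have pairwise negative products.
  have h1 := hd hyz hxy hxz hey hez
  have h2 := hd hyw hxy hxw hey hew
  have h3 := hd hzw hxz hxw hez hew
  have h4 := mul_pos_of_neg_of_neg h1 h2
  have h5 := mul_nonneg (sq_nonneg (d y)) (neg_nonneg.2 h3.le)
  linarith

theorem kissingPoly_add_le_of_two {a b : ℝ} (hab : a ≤ b) (ha : 99 / 140 ≤ a)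
    (h : a ^ 2 + b ^ 2 - a * b ≤ 3 / 4) : kissingPoly (-a) + kissingPoly (-b) ≤ 1949 / 1000 := by
  have mono : ∀ c, b ≤ c → c ≤ 49 / 50 → kissingPoly (-b) ≤ kissingPoly (-c) := fun c hbc hc =>
    monotoneOn_kissingPoly_neg ⟨ha.trans hab, hbc.trans hc⟩ ⟨(ha.trans hab).trans hbc, hc⟩ hbc
  rcases le_total a (4 / 5) with h4 | h4
  -- This is the tangent to the ellipse `a ^ 2 + b ^ 2 - a * b = 3 / 4` at (11/14, 13/14).
  · have := mono (7 / 5 - 3 / 5 * a)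
      (by nlinarith [sq_nonneg (a - 11 / 14), sq_nonneg (b - 13 / 14),
        sq_nonneg (a - 11 / 14 - (b - 13 / 14))]) (by linarith)
    linarith [kissingPoly_neg_add_le_lower ha h4]
  · have ha' : a ≤ 13 / 15 := by nlinarith
    -- The point (16/19, 17/19) lies slightly outside the ellipse; its polar-form inequality, from
    -- positivity of the quadratic form, gives this line.
    have := mono (725 / 456 - 5 / 6 * a)
      (by nlinarith [sq_nonneg (a - 16 / 19), sq_nonneg (b - 17 / 19),
        sq_nonneg (a - 16 / 19 - (b - 17 / 19))]) (by linarith)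
    linarith [kissingPoly_neg_add_le_upper h4 ha']

theorem kissingPoly_add_add_le_of_three {a b c : ℝ} (ha : 99 / 140 ≤ a) (hb : 99 / 140 ≤ b)
    (hc : 99 / 140 ≤ c) (ha' : a ≤ 1) (hb' : b ≤ 1) (hc' : c ≤ 1)
    (h6 : (a + b + c) ^ 2 ≤ 6) (h : a ^ 2 + b ^ 2 + c ^ 2 - (a + b + c) ^ 2 / 4 ≤ 1 / 2) :
    kissingPoly (-a) + kissingPoly (-b) + kissingPoly (-c) ≤ 1949 / 1000 := by
  have hS : a + b + c ≤ 2.4495 := by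
    by_contra! hS
    nlinarith
  -- With `S = a + b + c`, the majorants and `h` leave the convex quadratic `16.7 - 14 * S + 3.25 *
  -- S ^ 2`, which is within budget at both ends of the range of `S`.
  nlinarith [kissingPoly_neg_le_quadratic ha ha', kissingPoly_neg_le_quadratic hb hb',
    kissingPoly_neg_le_quadratic hc hc',
    mul_nonneg (sub_nonneg.2 hS) (show 0 ≤ a + b + c - 297 / 140 by linarith)]

end Cap

/-! ### The upper bound -/

theorem sum_kissingPoly_lt {T : Finset (EuclideanSpace ℝ (Fin 3))} (hT : ∀ x ∈ T, ‖x‖ = 1)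
    (hsep : ∀ x ∈ T, ∀ y ∈ T, x ≠ y → inner ℝ x y ≤ 1 / 2)
    {x : EuclideanSpace ℝ (Fin 3)} (hx : x ∈ T) :
    ∑ y ∈ T, kissingPoly (inner ℝ x y) < 13 := by
  classical
  have he : ‖-x‖ = 1 := by rw [norm_neg, hT x hx]
  set J := (T.erase x).filter (fun y => 99 / 140 ≤ inner ℝ (-x) y) with hJ
  have hJT : ∀ y ∈ J, y ∈ T := fun y hy => Finset.mem_of_mem_erase (Finset.mem_filter.1 hy).1
  have hJ1 : ∀ y ∈ J, ‖y‖ = 1 := fun y hy => hT y (hJT y hy)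
  have hJc : ∀ y ∈ J, 99 / 140 ≤ inner ℝ (-x) y := fun y hy => (Finset.mem_filter.1 hy).2
  have hJs : ∀ y ∈ J, ∀ z ∈ J, y ≠ z → inner ℝ y z ≤ 1 / 2 :=
    fun y hy z hz => hsep y (hJT y hy) z (hJT z hz)
  have hle : ∀ y ∈ T, inner ℝ (-x) y ≤ 1 := fun y hy => by
    have := real_inner_le_norm (-x) y
    rwa [he, hT y hy, one_mul] at this
  have hsum : ∑ y ∈ T.erase x, kissingPoly (inner ℝ x y)
      ≤ ∑ y ∈ J, kissingPoly (-inner ℝ (-x) y) := by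
    rw [hJ, Finset.sum_filter]
    refine Finset.sum_le_sum fun y hy => ?_
    have hy' := Finset.mem_erase.1 hy
    split_ifs with h
    · rw [inner_neg_left, neg_neg]
    · rw [inner_neg_left] at h
      exact kissingPoly_nonpos (by linarith) (hsep x hx y hy'.2 hy'.1.symm)
  have hcard : J.card ≤ 3 := by
    by_contra! hc
    obtain ⟨K, hKJ, hK⟩ := Finset.exists_subset_card_eq (Nat.succ_le_of_lt hc)
    obtain ⟨p, q, r, s, hpq, hpr, hps, hqr, hqs, hrs, rfl⟩ := Finset.card_eq_four.1 hK
    simp only [Finset.insert_subset_iff, Finset.singleton_subset_iff] at hKJ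
    obtain ⟨hp, hq, hr, hs⟩ := hKJ
    exact not_four_in_cap he (hJ1 p hp) (hJs _ hp _ hq hpq)
      (hJs _ hp _ hr hpr) (hJs _ hp _ hs hps) (hJs _ hq _ hr hqr) (hJs _ hq _ hs hqs)
      (hJs _ hr _ hs hrs) (hJc _ hp) (hJc _ hq) (hJc _ hr) (hJc _ hs)
  have hcap : ∑ y ∈ J, kissingPoly (-inner ℝ (-x) y) ≤ 1949 / 1000 := by
    have h1 := fun y hy => hle y (hJT y hy)
    clear_value J
    have hcases : J.card = 0 ∨ J.card = 1 ∨ J.card = 2 ∨ J.card = 3 := by omega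
    rcases hcases with h | h | h | h
    · rw [Finset.card_eq_zero.1 h, Finset.sum_empty]
      norm_num
    · obtain ⟨p, rfl⟩ := Finset.card_eq_one.1 h
      rw [Finset.sum_singleton]
      have hp := Finset.mem_singleton_self p
      exact kissingPoly_neg_le (hJc p hp) (h1 p hp)
    · obtain ⟨p, q, hpq, rfl⟩ := Finset.card_eq_two.1 h
      have hp : p ∈ ({p, q} : Finset _) := by simp
      have hq : q ∈ ({p, q} : Finset _) := by simp
      rw [Finset.sum_pair hpq]
      have hpc := hJc p hp
      have hqc := hJc q hq
      have h := sq_add_sq_sub_mul_le he (hJ1 p hp) (hJ1 q hq) (hJs p hp q hq hpq)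
        (by linarith [h1 q hq]) (by linarith [h1 p hp])
      rcases le_total (inner ℝ (-x) p) (inner ℝ (-x) q) with hl | hl
      · exact kissingPoly_add_le_of_two hl hpc h
      · rw [add_comm]
        exact kissingPoly_add_le_of_two hl hqc (by linarith)
    · obtain ⟨p, q, r, hpq, hpr, hqr, rfl⟩ := Finset.card_eq_three.1 h
      have hp : p ∈ ({p, q, r} : Finset _) := by simp
      have hq : q ∈ ({p, q, r} : Finset _) := by simp
      have hr : r ∈ ({p, q, r} : Finset _) := by simp
      rw [Finset.sum_insert (by simp [hpq, hpr]), Finset.sum_pair hqr, ← add_assoc]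
      have hpc := hJc p hp
      have hqc := hJc q hq
      have hrc := hJc r hr
      have h6 := add_add_sq_le_six he (hJ1 p hp) (hJ1 q hq) (hJ1 r hr) (hJs p hp q hq hpq)
        (hJs p hp r hr hpr) (hJs q hq r hr hqr)
      -- A quarter of the sum is then at most 5/8, below 99/140, so the weights in
      -- `sum_sq_sub_sq_sum_le` are nonnegative.
      have hS : inner ℝ (-x) p + inner ℝ (-x) q + inner ℝ (-x) r ≤ 5 / 2 := by
        by_contra! hS
        nlinarith
      exact kissingPoly_add_add_le_of_three hpc hqc hrc (h1 p hp) (h1 q hq) (h1 r hr) h6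
        (sum_sq_sub_sq_sum_le he (hJ1 p hp) (hJ1 q hq) (hJ1 r hr) (hJs p hp q hq hpq)
          (hJs p hp r hr hpr) (hJs q hq r hr hqr) (by linarith) (by linarith) (by linarith))
  rw [← Finset.add_sum_erase T _ hx, real_inner_self_eq_norm_sq, hT x hx, one_pow,
    kissingPoly_one]
  linarith

theorem card_le_twelve {T : Finset (EuclideanSpace ℝ (Fin 3))} (hT : ∀ x ∈ T, ‖x‖ = 1)
    (hsep : ∀ x ∈ T, ∀ y ∈ T, x ≠ y → inner ℝ x y ≤ 1 / 2) : T.card ≤ 12 := by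
  by_contra! hc
  have hne : T.Nonempty := Finset.card_pos.1 (by omega)
  have h1 := card_sq_le_sum_sum_kissingPoly hT
  have h2 := Finset.sum_lt_sum_of_nonempty hne fun x hx => sum_kissingPoly_lt hT hsep hx
  rw [Finset.sum_const, nsmul_eq_mul] at h2
  have h3 : (13 : ℝ) ≤ T.card := by exact_mod_cast hc
  nlinarith

/-! ### Kissing configurations -/

theorem nonOverlapping_iff {d : ℕ} {a b : EuclideanSpace ℝ (Fin d)} :
    NonOverlapping a b ↔ 2 ≤ dist a b := by
  rw [NonOverlapping, disjoint_ball_ball_iff one_pos one_pos, one_add_one_eq_two]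

theorem touching_iff {d : ℕ} {a b : EuclideanSpace ℝ (Fin d)} : Touching a b ↔ dist a b = 2 := by
  rw [Touching, nonOverlapping_iff]
  constructor
  · rintro ⟨⟨c, hca, hcb⟩, h⟩
    rw [Metric.mem_sphere] at hca hcb
    have := dist_triangle_left a b c
    linarith
  · refine fun h => ⟨⟨midpoint ℝ a b, ?_, ?_⟩, h.ge⟩
    · rw [Metric.mem_sphere, dist_midpoint_left, h]
      norm_num
    · rw [Metric.mem_sphere, dist_midpoint_right, h]
      norm_num

theorem IsKissingConfiguration.encard_le {o : EuclideanSpace ℝ (Fin 3)}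
    {S : Set (EuclideanSpace ℝ (Fin 3))} (hS : IsKissingConfiguration o S) : S.encard ≤ 12 := by
  classical
  by_contra! hc
  -- Passing to exactly 13 centres also covers infinite `S`.
  obtain ⟨R, hRS, hR⟩ := Set.exists_subset_encard_eq (Order.add_one_le_of_lt hc)
  have hfin : R.Finite := Set.finite_of_encard_eq_coe (k := 13) (by rw [hR]; norm_num)
  set φ : EuclideanSpace ℝ (Fin 3) → EuclideanSpace ℝ (Fin 3) := fun c => (1 / 2 : ℝ) • (c - o)
  have hφ : Function.Injective φ := fun a b h =>
    sub_left_injective (smul_right_injective _ (by norm_num : (1 / 2 : ℝ) ≠ 0) h)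
  have hcard : (hfin.toFinset.image φ).card = 13 := by
    rw [Finset.card_image_of_injective _ hφ, ← ENat.natCast_inj, ← hfin.encard_eq_coe_toFinset_card, hR]
    norm_num
  have hnorm : ∀ c ∈ R, ‖φ c‖ = 1 := fun c hc => by
    have := touching_iff.1 (hS.1 c (hRS hc))
    rw [norm_smul, ← dist_eq_norm, this]
    norm_num
  have := card_le_twelve (T := hfin.toFinset.image φ) (by simpa using hnorm) (by
    simp only [Finset.mem_image, Set.Finite.mem_toFinset]
    rintro _ ⟨a, ha, rfl⟩ _ ⟨b, hb, rfl⟩ hab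
    have h := nonOverlapping_iff.1 (hS.2 (hRS ha) (hRS hb) fun h => hab (by rw [h]))
    have hd : 1 ≤ ‖φ a - φ b‖ := by
      rw [show φ a - φ b = (1 / 2 : ℝ) • (a - b) by
        simp only [φ, ← smul_sub, sub_sub_sub_cancel_right], norm_smul, ← dist_eq_norm]
      norm_num
      linarith
    have := norm_sub_sq_real (φ a) (φ b)
    rw [hnorm a ha, hnorm b hb] at this
    nlinarith)
  omega

/-- The minimal vectors of the face-centred cubic lattice. -/
def fccVectors : Finset (Fin 3 → ℤ) :=
  (Fintype.piFinset fun _ => {-1, 0, 1}).filter fun v => v 0 ^ 2 + v 1 ^ 2 + v 2 ^ 2 = 2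

theorem exists_isKissingConfiguration (o : EuclideanSpace ℝ (Fin 3)) :
    ∃ S : Set (EuclideanSpace ℝ (Fin 3)), IsKissingConfiguration o S ∧ S.encard = 12 := by
  classical
  set φ : (Fin 3 → ℤ) → EuclideanSpace ℝ (Fin 3) :=
    fun v => o + WithLp.toLp 2 fun i => √2 * (v i : ℝ)
  have hdist : ∀ v w, dist (φ v) (φ w)
      = √(2 * (((v 0 - w 0) ^ 2 + (v 1 - w 1) ^ 2 + (v 2 - w 2) ^ 2 : ℤ) : ℝ)) := fun v w => by
    simp only [φ, dist_add_left, EuclideanSpace.dist_eq, Fin.sum_univ_three, Real.dist_eq, sq_abs,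
      ← mul_sub, mul_pow, Real.sq_sqrt zero_le_two]
    push_cast
    ring_nf
  have hsep : ∀ v ∈ fccVectors, ∀ w ∈ fccVectors, v ≠ w →
      2 ≤ (v 0 - w 0) ^ 2 + (v 1 - w 1) ^ 2 + (v 2 - w 2) ^ 2 := by decide +kernel
  have htwo : √(2 * ((2 : ℤ) : ℝ)) = 2 := by
    rw [Real.sqrt_eq_iff_mul_self_eq] <;> norm_num
  have hle : ∀ v ∈ fccVectors, ∀ w ∈ fccVectors, v ≠ w → 2 ≤ dist (φ v) (φ w) :=
    fun v hv w hw hvw => by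
      rw [hdist]
      refine htwo.ge.trans (Real.sqrt_le_sqrt (mul_le_mul_of_nonneg_left ?_ zero_le_two))
      exact_mod_cast hsep v hv w hw hvw
  have hinj : Set.InjOn φ fccVectors := fun v hv w hw h => by
    by_contra hvw
    have := hle v hv w hw hvw
    rw [h, dist_self] at this
    norm_num at this
  refine ⟨φ '' fccVectors, ⟨?_, ?_⟩, ?_⟩
  · rintro _ ⟨v, hv, rfl⟩
    have ho : φ 0 = o := by
      ext i
      simp [φ]
    have hv2 := (Finset.mem_filter.1 hv).2
    have h := hdist v 0
    simp only [ho, Pi.zero_apply, sub_zero, hv2, htwo] at h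
    exact touching_iff.2 h
  · rintro _ ⟨v, hv, rfl⟩ _ ⟨w, hw, rfl⟩ hvw
    exact nonOverlapping_iff.2 (hle v hv w hw fun h => hvw (by rw [h]))
  · rw [hinj.encard_image, Set.encard_coe_eq_coe_finsetCard,
      show fccVectors.card = 12 by decide +kernel]
    rfl

theorem theorem1 :
    kissingNumber 3 = 12 ∧
      ∀ o : EuclideanSpace ℝ (Fin 3),
        (∀ S : Set (EuclideanSpace ℝ (Fin 3)), IsKissingConfiguration o S → S.encard ≤ 12) ∧
          ∃ S : Set (EuclideanSpace ℝ (Fin 3)), IsKissingConfiguration o S ∧ S.encard = 12 := by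
  refine ⟨le_antisymm (iSup₂_le fun S hS => hS.encard_le) ?_,
    fun o => ⟨fun S hS => hS.encard_le, exists_isKissingConfiguration o⟩⟩
  obtain ⟨S, hS, h12⟩ := exists_isKissingConfiguration 0
  exact h12 ▸ le_iSup₂ (f := fun S (_ : IsKissingConfiguration 0 S) => S.encard) S hS
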